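/- Let $\Gamma$ be a countable discrete group with left regular representation $\lambda$ on $\ell_2(\Gamma)$, let $\mathrm{vNa}(\Gamma)$ be its group von Neumann algebra (the weak operator closure of $\mathrm{span}\{\lambda(\gamma)\}_{\gamma\in\Gamma}$) with trace $\tau(F)=\langle F\delta_e,\delta_e\rangle$, and for $p=1,2$ let $L^p(\mathrm{vNa}(\Gamma))$ be the completion of $\mathrm{vNa}(\Gamma)$ in the norm $\|F\|_p=\tau(|F|^p)^{1/p}$, where $|F|=(F^*F)^{1/2}$. The trace $\tau$ and the products of $\mathrm{vNa}(\Gamma)$ are extended to these spaces by continuity. Inner products are linear in the first variable. Let $(\mathcal X,\mu)$ be a $\sigma$-finite measure space and $\sigma$ an action of $\Gamma$ on $\mathcal X$ by measurable maps $\sigma_\gamma$ which is quasi-$\Gamma$-invariant: there are measurable functions $J_\sigma(\gamma,\cdot):\mathcal X\to(0,\infty)$ with $\mu(\sigma_\gamma(E))=\int_E J_\sigma(\gamma,x)\,d\mu(x)$ for all $\gamma\in\Gamma$ and all measurable $E\subset\mathcal X$. Let $T_\sigma$ be the unitary representation of $\Gamma$ on $L^2(\mathcal X,\mu)$ given by $T_\sigma(\gamma)\psi(x)=J_\sigma(\gamma^{-1},x)^{1/2}\,\psi(\sigma_{\gamma^{-1}}(x))$,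 and define the noncommutative Zak transform by $$Z_\sigma[\psi](x)=\sum_{\gamma\in\Gamma}\big(T_\sigma(\gamma)\psi(x)\big)\,\lambda(\gamma)^*.$$ Suppose that $\sigma$ has the tiling property with tiling set $C$, that is, $C\subset\mathcal X$ is $\mu$-measurable, $\mu(\sigma_{\gamma_1}(C)\cap\sigma_{\gamma_2}(C))=0$ for $\gamma_1\neq\gamma_2$, and $\mu\big(\mathcal X\setminus\bigcup_{\gamma\in\Gamma}\sigma_\gamma(C)\big)=0$. Then: (i) For every $\psi\in L^2(\mathcal X,\mu)$ the series $Z_\sigma[\psi](x)$ converges in $L^2(\mathrm{vNa}(\Gamma))$ for almost every $x\in\mathcal X$. The map $\psi\mapsto Z_\sigma[\psi]|_C$ is a linear isometry $L^2(\mathcal X,\mu)\to L^2\big((C,\mu),L^2(\mathrm{vNa}(\Gamma))\big)$, and for all $\gamma\in\Gamma$ one has $Z_\sigma[T_\sigma(\gamma)\psi](x)=\lambda(\gamma)Z_\sigma[\psi](x)$ for almost every $x\in\mathcal X$. (ii) The representation $T_\sigma$ is dual integrable, with bracket $$[\varphi,\psi]=\int_C Z_\sigma[\varphi](x)\,Z_\sigma[\psi](x)^*\,d\mu(x)\qquad(\varphi,\psi\in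 L^2(\mathcal X,\mu)).$$ That is, the integrand is Bochner integrable over $C$ with values in $L^1(\mathrm{vNa}(\Gamma))$, and $\langle\varphi,T_\sigma(\gamma)\psi\rangle=\tau\big([\varphi,\psi]\lambda(\gamma)^*\big)$ for all $\varphi,\psi\in L^2(\mathcal X,\mu)$ and all $\gamma\in\Gamma$. -/

import Mathlib

open MeasureTheory

noncomputable section

namespace NCZak

section GroupAlgebra

variable (Γ : Type*)

/-- The Hilbert space `ℓ²(Γ)`. -/
def Ell2 : Type _ := lp (fun _ : Γ => ℂ) 2

instance : NormedAddCommGroup (Ell2 Γ) := inferInstanceAs (NormedAddCommGroup (lp (fun _ : Γ => ℂ) 2))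

instance : InnerProductSpace ℂ (Ell2 Γ) :=
  inferInstanceAs (InnerProductSpace ℂ (lp (fun _ : Γ => ℂ) 2))

instance : CompleteSpace (Ell2 Γ) := inferInstanceAs (CompleteSpace (lp (fun _ : Γ => ℂ) 2))

instance : CoeFun (Ell2 Γ) (fun _ => Γ → ℂ) := ⟨fun f => f.1⟩

/-- Bounded operators on `ℓ²(Γ)`. -/
abbrev BEll2 : Type _ := Ell2 Γ →L[ℂ] Ell2 Γ

variable {Γ}

theorem Ell2.ext {f g : Ell2 Γ} (h : ∀ x, f x = g x) : f = g := lp.ext (funext h)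

open Classical in
/-- The canonical basis vector `δ_γ` of `ℓ²(Γ)`. -/
def delta (γ : Γ) : Ell2 Γ := lp.single 2 γ (1 : ℂ)

open Classical in
theorem delta_apply (γ x : Γ) : delta γ x = if x = γ then 1 else 0 := by
  refine (lp.single_apply (E := fun _ : Γ => ℂ) 2 γ (1 : ℂ) x).trans ?_
  rw [Pi.single_apply]

open Classical in
theorem inner_delta (γ : Γ) (f : Ell2 Γ) : inner ℂ (delta γ) f = f γ := by
  refine (lp.inner_single_left (G := fun _ : Γ => ℂ) γ (1 : ℂ) f).trans ?_
  simp

theorem norm_delta (γ : Γ) : ‖delta γ‖ = 1 := by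
  classical
  refine (lp.norm_single (E := fun _ : Γ => ℂ) (p := 2) (by norm_num) γ (1 : ℂ)).trans ?_
  simp

theorem wot_smul_mul (c : ℂ) (A B : Ell2 Γ →WOT[ℂ] Ell2 Γ) : (c • A) * B = c • (A * B) :=
  ContinuousLinearMapWOT.ext fun _ => rfl

theorem wot_mul_smul (c : ℂ) (A B : Ell2 Γ →WOT[ℂ] Ell2 Γ) : A * (c • B) = c • (A * B) :=
  ContinuousLinearMapWOT.ext fun x => A.toCLM.map_smul c (B x)

variable [Group Γ]

/-- Left translation `(γ f)(x) = f (γ⁻¹ x)` on `ℓ²(Γ)`, as a linear isometry. -/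
def translate (γ : Γ) : Ell2 Γ →ₗᵢ[ℂ] Ell2 Γ where
  toFun f := ⟨fun x => f (γ⁻¹ * x), by
    have h := lp.memℓp (E := fun _ : Γ => ℂ) (p := 2) f
    rw [memℓp_gen_iff (by norm_num)] at h
    exact (memℓp_gen_iff (by norm_num)).mpr (h.comp_injective (mul_right_injective γ⁻¹))⟩
  map_add' f g := Ell2.ext fun _ => rfl
  map_smul' c f := Ell2.ext fun _ => rfl
  norm_map' f := by
    have h2 : (0 : ℝ) < (2 : ENNReal).toReal := by norm_num
    refine (lp.norm_eq_tsum_rpow (E := fun _ : Γ => ℂ) h2 _).trans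
      (Eq.trans ?_ (lp.norm_eq_tsum_rpow (E := fun _ : Γ => ℂ) h2 f).symm)
    congr 1
    exact (Equiv.mulLeft γ⁻¹).tsum_eq (fun x => ‖f x‖ ^ (2 : ENNReal).toReal)

theorem translate_apply (γ : Γ) (f : Ell2 Γ) (x : Γ) : translate γ f x = f (γ⁻¹ * x) := rfl

theorem translate_translate (γ γ' : Γ) (f : Ell2 Γ) :
    translate γ (translate γ' f) = translate (γ * γ') f := by
  refine Ell2.ext fun x => ?_
  rw [translate_apply, translate_apply, translate_apply]
  exact congrArg f.1 (by group)

theorem translate_one (f : Ell2 Γ) : translate 1 f = f := by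
  refine Ell2.ext fun x => ?_
  rw [translate_apply]
  exact congrArg f.1 (by group)

variable (Γ) in
/-- The left regular representation `λ` of `Γ` on `ℓ²(Γ)`, a homomorphism to the unitary group. -/
def leftReg : Γ →* (Ell2 Γ ≃ₗᵢ[ℂ] Ell2 Γ) where
  toFun γ :=
    { toLinearEquiv := LinearEquiv.ofLinearMap (translate γ).toLinearMap (translate γ⁻¹).toLinearMap
        (by ext1 f; simp [translate_translate, translate_one])
        (by ext1 f; simp [translate_translate, translate_one])
      norm_map' := (translate γ).norm_map }
  map_one' := by ext1 f; exact translate_one f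
  map_mul' γ γ' := by ext1 f; exact (translate_translate γ γ' f).symm

theorem leftReg_delta (γ γ' : Γ) : leftReg Γ γ (delta γ') = delta (γ * γ') := by
  classical
  refine Ell2.ext fun x => ?_
  change delta γ' (γ⁻¹ * x) = delta (γ * γ') x
  rw [delta_apply, delta_apply]
  simp only [inv_mul_eq_iff_eq_mul]

/-- `λ(γ)` as a bounded operator. -/
def lam (γ : Γ) : BEll2 Γ := ((leftReg Γ γ).toContinuousLinearEquiv : Ell2 Γ →L[ℂ] Ell2 Γ)

theorem lam_apply (γ : Γ) (f : Ell2 Γ) : lam γ f = leftReg Γ γ f := rfl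

theorem lam_mul (γ γ' : Γ) : lam γ * lam γ' = lam (γ * γ') := by
  ext1 f
  simp [lam_apply]

theorem lam_one : lam (1 : Γ) = 1 := by
  ext1 f
  simp [lam_apply]

theorem star_lam (γ : Γ) : star (lam γ) = lam γ⁻¹ := by
  rw [ContinuousLinearMap.star_eq_adjoint]
  symm
  rw [ContinuousLinearMap.eq_adjoint_iff]
  intro f g
  rw [lam_apply, lam_apply, ← (leftReg Γ γ).inner_map_map]
  congr 1
  rw [map_inv]
  exact (leftReg Γ γ).apply_symm_apply f

variable (Γ) in
/-- The trigonometric polynomials: the linear span of the `λ(γ)`, regarded as a star subalgebra of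
the bounded operators with the weak operator topology. -/
def trigPoly : StarSubalgebra ℂ (Ell2 Γ →WOT[ℂ] Ell2 Γ) where
  carrier := Submodule.span ℂ (Set.range fun γ : Γ => ContinuousLinearMapWOT.ofCLM (lam γ))
  add_mem' := fun h h' => Submodule.add_mem _ h h'
  mul_mem' := by
    intro a b ha hb
    induction ha using Submodule.span_induction with
    | mem x hx =>
      obtain ⟨γ, rfl⟩ := hx
      induction hb using Submodule.span_induction with
      | mem y hy =>
        obtain ⟨γ', rfl⟩ := hy
        refine Submodule.subset_span ⟨γ * γ', ?_⟩
        simp only [← lam_mul, ContinuousLinearMapWOT.ofCLM_mul]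
      | zero => simp
      | add y z _ _ hy hz => rw [mul_add]; exact Submodule.add_mem _ hy hz
      | smul c y _ hy => rw [wot_mul_smul]; exact Submodule.smul_mem _ _ hy
    | zero => simp
    | add y z _ _ hy hz => rw [add_mul]; exact Submodule.add_mem _ hy hz
    | smul c y _ hy => rw [wot_smul_mul]; exact Submodule.smul_mem _ _ hy
  algebraMap_mem' := by
    intro r
    rw [Algebra.algebraMap_eq_smul_one]
    refine Submodule.smul_mem _ _ (Submodule.subset_span ⟨1, ?_⟩)
    simp [lam_one]
  star_mem' := by
    intro a ha
    induction ha using Submodule.span_induction with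
    | mem x hx =>
      obtain ⟨γ, rfl⟩ := hx
      refine Submodule.subset_span ⟨γ⁻¹, ?_⟩
      simp only [← star_lam]
      rfl
    | zero => simp
    | add y z _ _ hy hz => rw [star_add]; exact Submodule.add_mem _ hy hz
    | smul c y _ hy => rw [star_smul]; exact Submodule.smul_mem _ _ hy

variable (Γ) in
/-- The group von Neumann algebra `vNa(Γ)`: the closure of the trigonometric polynomials in the weak
operator topology. -/
def vNa : StarSubalgebra ℂ (BEll2 Γ) where
  carrier := {F | ContinuousLinearMapWOT.ofCLM F ∈ closure (trigPoly Γ : Set (Ell2 Γ →WOT[ℂ] Ell2 Γ))}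
  add_mem' := fun h h' => (trigPoly Γ).topologicalClosure.add_mem h h'
  mul_mem' := fun h h' => (trigPoly Γ).topologicalClosure.mul_mem h h'
  algebraMap_mem' := fun r => (trigPoly Γ).topologicalClosure.algebraMap_mem r
  star_mem' := fun h => (trigPoly Γ).topologicalClosure.star_mem' h

theorem lam_mem (γ : Γ) : lam γ ∈ vNa Γ :=
  subset_closure (Submodule.subset_span ⟨γ, rfl⟩)

/-- `λ(γ)` as an element of `vNa(Γ)`. -/
def lamV (γ : Γ) : vNa Γ := ⟨lam γ, lam_mem γ⟩

instance isClosed_vNa : IsClosed (vNa Γ : Set (BEll2 Γ)) :=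
  isClosed_closure.preimage ContinuousLinearMapWOT.continuous_ofCLM

variable (Γ) in
/-- The standard trace `τ(F) = ⟨F δ_e, δ_e⟩`. -/
def tau : BEll2 Γ →ₗ[ℂ] ℂ where
  toFun F := inner ℂ (delta 1) (F (delta 1))
  map_add' F G := by simp
  map_smul' c F := by simp

theorem tau_apply (F : BEll2 Γ) : tau Γ F = inner ℂ (delta 1) (F (delta 1)) := rfl

theorem tau_star_mul (F G : BEll2 Γ) :
    tau Γ (star F * G) = inner ℂ (F (delta 1)) (G (delta 1)) := by
  rw [tau_apply, mul_apply_eq_comp, ContinuousLinearMap.star_eq_adjoint,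
    ContinuousLinearMap.adjoint_inner_right]

theorem tau_star (F : BEll2 Γ) : tau Γ (star F) = star (tau Γ F) := by
  rw [← mul_one (star F), tau_star_mul, tau_apply, RCLike.star_def, inner_conj_symm]
  rfl

theorem norm_tau_le (F : BEll2 Γ) : ‖tau Γ F‖ ≤ ‖F‖ := by
  rw [tau_apply]
  refine (norm_inner_le_norm _ _).trans ?_
  rw [norm_delta, one_mul]
  simpa [norm_delta] using F.le_opNorm (delta 1)

theorem tau_lam_comm (γ γ' : Γ) : tau Γ (lam γ * lam γ') = tau Γ (lam γ' * lam γ) := by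
  classical
  rw [lam_mul, lam_mul]
  simp only [tau_apply, lam_apply, leftReg_delta, mul_one]
  simp only [inner_delta, delta_apply]
  have h : (1 = γ * γ') ↔ (1 = γ' * γ) := by
    rw [eq_comm, mul_eq_one_comm, eq_comm]
  by_cases h1 : 1 = γ * γ'
  · rw [if_pos h1, if_pos (h.mp h1)]
  · rw [if_neg h1, if_neg (fun h2 => h1 (h.mpr h2))]

/-- The trace property. -/
theorem tau_mul_comm {F G : BEll2 Γ} (hF : F ∈ vNa Γ) (hG : G ∈ vNa Γ) :
    tau Γ (F * G) = tau Γ (G * F) := by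
  let t : (Ell2 Γ →WOT[ℂ] Ell2 Γ) → ℂ := fun A => inner ℂ (delta 1) (A (delta 1))
  have ht : Continuous t := ContinuousLinearMapWOT.continuous_inner_apply continuous_id _ _
  suffices H : ∀ A ∈ closure (trigPoly Γ : Set (Ell2 Γ →WOT[ℂ] Ell2 Γ)),
      ∀ B ∈ closure (trigPoly Γ : Set (Ell2 Γ →WOT[ℂ] Ell2 Γ)), t (A * B) = t (B * A) from
    H _ hF _ hG
  have step : ∀ B, (∀ A ∈ (trigPoly Γ : Set (Ell2 Γ →WOT[ℂ] Ell2 Γ)), t (A * B) = t (B * A)) →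
      ∀ A ∈ closure (trigPoly Γ : Set (Ell2 Γ →WOT[ℂ] Ell2 Γ)), t (A * B) = t (B * A) := by
    intro B hB A hA
    exact closure_minimal (t := {A | t (A * B) = t (B * A)}) hB
      (isClosed_eq (ht.comp (continuous_mul_const B)) (ht.comp (continuous_const_mul B))) hA
  have tadd : ∀ A B, t (A + B) = t A + t B := fun A B => by simp [t]
  have tsmul : ∀ (c : ℂ) A, t (c • A) = c * t A := fun c A => by simp [t]
  have base : ∀ A ∈ (trigPoly Γ : Set (Ell2 Γ →WOT[ℂ] Ell2 Γ)),
      ∀ B ∈ (trigPoly Γ : Set (Ell2 Γ →WOT[ℂ] Ell2 Γ)), t (A * B) = t (B * A) := by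
    intro A hA B hB
    induction hA using Submodule.span_induction with
    | mem x hx =>
      obtain ⟨γ, rfl⟩ := hx
      induction hB using Submodule.span_induction with
      | mem y hy =>
        obtain ⟨γ', rfl⟩ := hy
        exact tau_lam_comm γ γ'
      | zero => simp
      | add y z _ _ hy hz => rw [mul_add, add_mul, tadd, tadd, hy, hz]
      | smul c y _ hy => rw [wot_mul_smul, wot_smul_mul, tsmul, tsmul, hy]
    | zero => simp
    | add y z _ _ hy hz => rw [mul_add, add_mul, tadd, tadd, hy, hz]
    | smul c y _ hy => rw [wot_mul_smul, wot_smul_mul, tsmul, tsmul, hy]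
  intro A hA
  refine step A (fun B hB => ?_) |> fun h B hB => (h B hB).symm
  exact (step B (fun A hA => base A hA B hB) A hA).symm

end GroupAlgebra

section Norms

variable {Γ : Type*} [Group Γ]

theorem norm_tau_mul_le {x a : BEll2 Γ} (hx : x ∈ vNa Γ) (ha : a ∈ vNa Γ) (h0 : 0 ≤ a) :
    ‖tau Γ (x * a)‖ ≤ ‖x‖ * (tau Γ a).re := by
  set b := CFC.sqrt a with hb
  have hbA : b ∈ vNa Γ := by
    rw [hb, CFC.sqrt_eq_real_sqrt a h0, cfcₙ_eq_cfc]
    exact cfc_mem _ ha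
  have hbb : b * b = a := CFC.sqrt_mul_sqrt_self a h0
  have hbs : star b = b := (CFC.sqrt_nonneg a).isSelfAdjoint.star_eq
  have h1 : tau Γ (x * a) = inner ℂ (b (delta 1)) (x (b (delta 1))) := by
    rw [← hbb, ← mul_assoc, tau_mul_comm ((vNa Γ).mul_mem hx hbA) hbA]
    conv_lhs => rw [← hbs]
    rw [hbs]
    nth_rewrite 1 [← hbs]
    rw [tau_star_mul]
    rfl
  have h2 : (tau Γ a).re = ‖b (delta 1)‖ ^ 2 := by
    rw [← hbb]
    nth_rewrite 1 [← hbs]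
    rw [tau_star_mul]
    exact inner_self_eq_norm_sq (𝕜 := ℂ) _
  rw [h1, h2]
  calc _ ≤ ‖b (delta 1)‖ * ‖x (b (delta 1))‖ := norm_inner_le_norm _ _
    _ ≤ ‖b (delta 1)‖ * (‖x‖ * ‖b (delta 1)‖) := by gcongr; exact x.le_opNorm _
    _ = _ := by ring

theorem abs_mem {F : BEll2 Γ} (hF : F ∈ vNa Γ) : CFC.abs F ∈ vNa Γ := by
  rw [CFC.abs, CFC.sqrt_eq_real_sqrt _ (star_mul_self_nonneg F), cfcₙ_eq_cfc]
  exact cfc_mem _ ((vNa Γ).mul_mem ((vNa Γ).star_mem' hF) hF)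

variable (Γ) in
/-- `‖F‖₁ = τ(|F|)`, where `|F| = (F* F)^{1/2}`. -/
def norm1 (F : BEll2 Γ) : ℝ := (tau Γ (CFC.abs F)).re

theorem norm1_nonneg (F : BEll2 Γ) : 0 ≤ norm1 Γ F :=
  ((ContinuousLinearMap.nonneg_iff_isPositive _).mp (CFC.abs_nonneg F)).re_inner_nonneg_right _

theorem approx_polar {F : BEll2 Γ} (hF : F ∈ vNa Γ) {ε : ℝ} (hε : 0 < ε) :
    ∃ u ∈ vNa Γ, ‖u‖ ≤ 1 ∧ F = u * (CFC.abs F + (ε : ℂ) • 1) ∧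
      norm1 Γ F ≤ ‖tau Γ (star u * F)‖ + ε := by
  set a := CFC.abs F with ha
  have h0 : 0 ≤ a := CFC.abs_nonneg F
  have hsa : IsSelfAdjoint a := h0.isSelfAdjoint
  have haA : a ∈ vNa Γ := abs_mem hF
  have hspec : ∀ t ∈ spectrum ℝ a, 0 ≤ t := fun t ht => spectrum_nonneg_of_nonneg h0 ht
  have hne : ∀ t ∈ spectrum ℝ a, t + ε ≠ 0 := fun t ht => by
    have := hspec t ht; positivity
  have hc : ContinuousOn (fun t : ℝ => (t + ε)⁻¹) (spectrum ℝ a) :=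
    ContinuousOn.inv₀ (by fun_prop) hne
  set v := cfc (fun t : ℝ => (t + ε)⁻¹) a with hv
  have hvA : v ∈ vNa Γ := cfc_mem _ haA
  have hvs : star v = v := (IsSelfAdjoint.cfc (f := fun t : ℝ => (t + ε)⁻¹) (a := a)).star_eq
  have haε : a + (ε : ℂ) • 1 = cfc (fun t : ℝ => t + ε) a := by
    rw [cfc_add_const ε (fun t => t) a, cfc_id' ℝ a, Algebra.algebraMap_eq_smul_one]
    rfl
  have hvinv : v * (a + (ε : ℂ) • 1) = 1 := by
    rw [haε, hv, ← cfc_mul _ _ a hc (by fun_prop)]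
    rw [← cfc_one ℝ a]
    exact cfc_congr fun t ht => inv_mul_cancel₀ (hne t ht)
  have hva : a * v = cfc (fun t : ℝ => t * (t + ε)⁻¹) a := by
    conv_lhs => rw [← cfc_id' ℝ a]
    rw [hv, ← cfc_mul _ _ _ (by fun_prop) (by simpa [cfc_id' ℝ a] using hc)]
  have hcomm : v * a = a * v := by
    rw [hva]
    conv_lhs => rw [← cfc_id' ℝ a]
    rw [cfc_id' ℝ a, hv]
    nth_rewrite 2 [← cfc_id' ℝ a]
    rw [← cfc_mul _ _ a hc (by fun_prop)]
    exact cfc_congr fun t _ => mul_comm _ _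
  have hnorm : ‖a * v‖ ≤ 1 := by
    rw [hva]
    refine norm_cfc_le zero_le_one fun t ht => ?_
    have h1 := hspec t ht
    rw [Real.norm_of_nonneg (by positivity), ← div_eq_mul_inv, div_le_one (by positivity)]
    linarith
  have hFF : star F * F = a * a := (CFC.abs_mul_abs F).symm
  have huF : star (F * v) * F = a * (a * v) := by
    rw [star_mul, hvs, mul_assoc, hFF, ← mul_assoc, hcomm, mul_assoc, hcomm]
  refine ⟨F * v, (vNa Γ).mul_mem hF hvA, ?_, ?_, ?_⟩
  · have h1 : star (F * v) * (F * v) = star (a * v) * (a * v) := by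
      rw [← mul_assoc, huF, star_mul, hvs, hsa.star_eq, hcomm, mul_assoc, mul_assoc, mul_assoc]
      congr 1
      rw [← mul_assoc v, hcomm, mul_assoc]
    have h2 : ‖F * v‖ * ‖F * v‖ = ‖a * v‖ * ‖a * v‖ := by
      rw [← CStarRing.norm_star_mul_self, h1, CStarRing.norm_star_mul_self]
    nlinarith [norm_nonneg (F * v), norm_nonneg (a * v)]
  · rw [mul_assoc, hvinv, mul_one]
  · have h1 : a = a * (a * v) + (ε : ℂ) • (a * v) := by
      conv_lhs => rw [← mul_one a, ← hvinv, ← mul_assoc, mul_add, mul_smul_comm, mul_one, mul_assoc,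
        hcomm]
    have h2 : norm1 Γ F = (tau Γ (star (F * v) * F)).re + ε * (tau Γ (a * v)).re := by
      rw [huF, norm1, ← ha]
      conv_lhs => rw [h1, map_add, map_smul, Complex.add_re, smul_eq_mul, Complex.re_ofReal_mul]
    have h3 : (tau Γ (a * v)).re ≤ 1 :=
      (Complex.re_le_norm _).trans ((norm_tau_le _).trans hnorm)
    have h4 := Complex.re_le_norm (tau Γ (star (F * v) * F))
    rw [h2]
    nlinarith

theorem tau_one : tau Γ (1 : BEll2 Γ) = 1 := by
  rw [tau_apply, one_apply_eq_self, inner_self_eq_norm_sq_to_K, norm_delta]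
  simp

theorem norm_tau_mul_le_norm1 {G F : BEll2 Γ} (hG : G ∈ vNa Γ) (hF : F ∈ vNa Γ) :
    ‖tau Γ (G * F)‖ ≤ ‖G‖ * norm1 Γ F := by
  have key : ∀ ε : ℝ, 0 < ε → ‖tau Γ (G * F)‖ ≤ ‖G‖ * norm1 Γ F + ‖G‖ * ε := by
    intro ε hε
    obtain ⟨u, hu, hu1, hFu, -⟩ := approx_polar hF hε
    have hpos : (0 : BEll2 Γ) ≤ (ε : ℂ) • 1 := by
      rw [Complex.coe_smul]
      exact smul_nonneg hε.le zero_le_one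
    have hmem : (ε : ℂ) • (1 : BEll2 Γ) ∈ vNa Γ := (vNa Γ).smul_mem (vNa Γ).one_mem _
    have h := norm_tau_mul_le ((vNa Γ).mul_mem hG hu) ((vNa Γ).add_mem (abs_mem hF) hmem)
      (add_nonneg (CFC.abs_nonneg F) hpos)
    rw [mul_assoc, ← hFu, map_add, map_smul, tau_one, smul_eq_mul, mul_one, Complex.add_re,
      Complex.ofReal_re] at h
    have h0 : 0 ≤ norm1 Γ F + ε := add_nonneg (norm1_nonneg F) hε.le
    calc _ ≤ ‖G * u‖ * (norm1 Γ F + ε) := h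
      _ ≤ (‖G‖ * ‖u‖) * (norm1 Γ F + ε) := by gcongr; exact norm_mul_le _ _
      _ ≤ (‖G‖ * 1) * (norm1 Γ F + ε) := by gcongr
      _ = _ := by ring
  refine le_of_forall_pos_le_add fun δ hδ => ?_
  refine (key (δ / (‖G‖ + 1)) (by positivity)).trans ?_
  gcongr
  rw [mul_div_assoc', div_le_iff₀ (by positivity)]
  nlinarith [norm_nonneg G]

theorem norm1_le_of_forall {F : BEll2 Γ} (hF : F ∈ vNa Γ) {M : ℝ}
    (h : ∀ G ∈ vNa Γ, ‖G‖ ≤ 1 → ‖tau Γ (G * F)‖ ≤ M) : norm1 Γ F ≤ M := by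
  refine le_of_forall_pos_le_add fun ε hε => ?_
  obtain ⟨u, hu, hu1, -, hle⟩ := approx_polar hF hε
  refine hle.trans ?_
  gcongr
  exact h _ ((vNa Γ).star_mem' hu) (by rwa [norm_star])

theorem norm1_add_le {F G : BEll2 Γ} (hF : F ∈ vNa Γ) (hG : G ∈ vNa Γ) :
    norm1 Γ (F + G) ≤ norm1 Γ F + norm1 Γ G := by
  refine norm1_le_of_forall ((vNa Γ).add_mem hF hG) fun K hK hK1 => ?_
  rw [mul_add, map_add]
  refine (norm_add_le _ _).trans (add_le_add ?_ ?_)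
  · exact (norm_tau_mul_le_norm1 hK hF).trans (mul_le_of_le_one_left (norm1_nonneg F) hK1)
  · exact (norm_tau_mul_le_norm1 hK hG).trans (mul_le_of_le_one_left (norm1_nonneg G) hK1)

theorem norm1_smul (c : ℂ) (F : BEll2 Γ) : norm1 Γ (c • F) = ‖c‖ * norm1 Γ F := by
  rw [norm1, CFC.abs_smul, ← Complex.coe_smul, map_smul, smul_eq_mul, Complex.re_ofReal_mul, norm1]

theorem norm1_mul_right_le {F K : BEll2 Γ} (hF : F ∈ vNa Γ) (hK : K ∈ vNa Γ) :
    norm1 Γ (F * K) ≤ ‖K‖ * norm1 Γ F := by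
  refine norm1_le_of_forall ((vNa Γ).mul_mem hF hK) fun G hG hG1 => ?_
  rw [← mul_assoc, tau_mul_comm ((vNa Γ).mul_mem hG hF) hK, ← mul_assoc]
  refine (norm_tau_mul_le_norm1 ((vNa Γ).mul_mem hK hG) hF).trans ?_
  gcongr
  · exact norm1_nonneg F
  · exact (norm_mul_le _ _).trans (mul_le_of_le_one_right (norm_nonneg _) hG1)

/-- Hölder's inequality `‖F G*‖₁ ≤ ‖F‖₂ ‖G‖₂`. -/
theorem norm1_mul_star_le {F G : BEll2 Γ} (hF : F ∈ vNa Γ) (hG : G ∈ vNa Γ) :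
    norm1 Γ (F * star G) ≤ ‖F (delta 1)‖ * ‖G (delta 1)‖ := by
  have hG' : star G ∈ vNa Γ := (vNa Γ).star_mem' hG
  refine norm1_le_of_forall ((vNa Γ).mul_mem hF hG') fun K hK hK1 => ?_
  rw [← mul_assoc, tau_mul_comm ((vNa Γ).mul_mem hK hF) hG', tau_star_mul]
  refine (norm_inner_le_norm _ _).trans ?_
  rw [mul_comm]
  gcongr
  exact (K.le_opNorm _).trans (mul_le_of_le_one_left (norm_nonneg _) hK1)

end Norms

section LpSpaces

variable (Γ : Type*) [Group Γ]

/-- `vNa(Γ)` equipped with the norm `‖F‖₁ = τ(|F|)`. -/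
def PreL1 : Type _ := vNa Γ

instance : AddCommGroup (PreL1 Γ) := inferInstanceAs (AddCommGroup (vNa Γ))

instance : Module ℂ (PreL1 Γ) := inferInstanceAs (Module ℂ (vNa Γ))

instance : SeminormedAddCommGroup (PreL1 Γ) :=
  AddGroupSeminorm.toSeminormedAddCommGroup
    { toFun := fun F : PreL1 Γ => norm1 Γ (F : vNa Γ).1
      map_zero' := by
        change norm1 Γ 0 = 0
        simpa using norm1_smul (Γ := Γ) 0 0
      add_le' := fun F G => norm1_add_le F.2 G.2
      neg' := fun F => by
        change norm1 Γ (-F.1) = norm1 Γ F.1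
        rw [norm1, CFC.abs_neg, norm1] }

instance : NormedSpace ℂ (PreL1 Γ) where
  norm_smul_le c F := (norm1_smul c F.1).le

/-- `L¹(vNa(Γ))`: the completion of `vNa(Γ)` in the norm `‖F‖₁ = τ(|F|)`. -/
def L1 : Type _ := UniformSpace.Completion (PreL1 Γ)

instance : NormedAddCommGroup (L1 Γ) :=
  inferInstanceAs (NormedAddCommGroup (UniformSpace.Completion (PreL1 Γ)))

instance : NormedSpace ℂ (L1 Γ) :=
  inferInstanceAs (NormedSpace ℂ (UniformSpace.Completion (PreL1 Γ)))

instance : CompleteSpace (L1 Γ) :=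
  inferInstanceAs (CompleteSpace (UniformSpace.Completion (PreL1 Γ)))

/-- `vNa(Γ)` equipped with the inner product `τ(F* G)`, whose norm is `‖F‖₂ = τ(|F|²)^{1/2}`. -/
def PreL2 : Type _ := vNa Γ

instance : AddCommGroup (PreL2 Γ) := inferInstanceAs (AddCommGroup (vNa Γ))

instance : Module ℂ (PreL2 Γ) := inferInstanceAs (Module ℂ (vNa Γ))

/-- The scalar product `τ(F* G)`, conjugate linear in the first variable as always in Mathlib. -/
@[reducible]
def preL2Core : PreInnerProductSpace.Core ℂ (PreL2 Γ) where
  inner F G := tau Γ (star (F : vNa Γ).1 * (G : vNa Γ).1)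
  conj_inner_symm F G := by
    rw [tau_star_mul, tau_star_mul, inner_conj_symm]
  re_inner_nonneg F := by
    rw [tau_star_mul]
    exact inner_self_nonneg
  add_left F G K := by
    rw [tau_star_mul, tau_star_mul, tau_star_mul, ← inner_add_left]
    rfl
  smul_left F G c := by
    rw [tau_star_mul, tau_star_mul, ← inner_smul_left]
    rfl

instance : SeminormedAddCommGroup (PreL2 Γ) :=
  InnerProductSpace.Core.toSeminormedAddCommGroup (c := preL2Core Γ)

instance : InnerProductSpace ℂ (PreL2 Γ) := InnerProductSpace.ofCore (preL2Core Γ)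

/-- `L²(vNa(Γ))`: the completion of `vNa(Γ)` in the norm `‖F‖₂ = τ(|F|²)^{1/2}`. -/
def L2 : Type _ := UniformSpace.Completion (PreL2 Γ)

instance : NormedAddCommGroup (L2 Γ) :=
  inferInstanceAs (NormedAddCommGroup (UniformSpace.Completion (PreL2 Γ)))

instance : InnerProductSpace ℂ (L2 Γ) :=
  inferInstanceAs (InnerProductSpace ℂ (UniformSpace.Completion (PreL2 Γ)))

instance : CompleteSpace (L2 Γ) :=
  inferInstanceAs (CompleteSpace (UniformSpace.Completion (PreL2 Γ)))

/-- The canonical map `vNa(Γ) → L¹(vNa(Γ))`. -/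
def toL1 : vNa Γ →ₗ[ℂ] L1 Γ :=
  (UniformSpace.Completion.toComplₗᵢ (𝕜 := ℂ) (E := PreL1 Γ)).toLinearMap

/-- The canonical map `vNa(Γ) → L²(vNa(Γ))`. -/
def toL2 : vNa Γ →ₗ[ℂ] L2 Γ :=
  (UniformSpace.Completion.toComplₗᵢ (𝕜 := ℂ) (E := PreL2 Γ)).toLinearMap

variable {Γ}

theorem denseRange_toL1 : DenseRange (toL1 Γ) :=
  UniformSpace.Completion.denseRange_coe (α := PreL1 Γ)

theorem denseRange_toL2 : DenseRange (toL2 Γ) :=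
  UniformSpace.Completion.denseRange_coe (α := PreL2 Γ)

theorem norm_toL1 (F : vNa Γ) : ‖toL1 Γ F‖ = (tau Γ (CFC.abs F.1)).re :=
  (UniformSpace.Completion.toComplₗᵢ (𝕜 := ℂ) (E := PreL1 Γ)).norm_map F

theorem inner_toL2 (F G : vNa Γ) :
    inner ℂ (toL2 Γ F) (toL2 Γ G) = tau Γ (star F.1 * G.1) :=
  (UniformSpace.Completion.toComplₗᵢ (𝕜 := ℂ) (E := PreL2 Γ)).inner_map_map F G

theorem norm_toL2 (F : vNa Γ) : ‖toL2 Γ F‖ = ‖F.1 (delta 1)‖ := by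
  have h : ‖toL2 Γ F‖ ^ 2 = ‖F.1 (delta 1)‖ ^ 2 := by
    rw [← inner_self_eq_norm_sq (𝕜 := ℂ), inner_toL2, tau_star_mul, inner_self_eq_norm_sq]
  exact (sq_eq_sq₀ (norm_nonneg _) (norm_nonneg _)).mp h

theorem norm_toL2_sq (F : vNa Γ) : ‖toL2 Γ F‖ ^ 2 = (tau Γ (CFC.abs F.1 ^ 2)).re := by
  rw [← inner_self_eq_norm_sq (𝕜 := ℂ), inner_toL2, sq, CFC.abs_mul_abs]
  rfl

variable (Γ) in
/-- The extension of the trace `τ` to `L¹(vNa(Γ))` by continuity. -/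
def trL1 : L1 Γ →L[ℂ] ℂ := ((tau Γ).comp (vNa Γ).subtype.toLinearMap).extendOfNorm (toL1 Γ)

theorem trL1_toL1 (F : vNa Γ) : trL1 Γ (toL1 Γ F) = tau Γ F.1 := by
  refine LinearMap.extendOfNorm_eq denseRange_toL1 ⟨‖(1 : BEll2 Γ)‖, fun F => ?_⟩ F
  have h := norm_tau_mul_le_norm1 (vNa Γ).one_mem F.2
  rw [one_mul] at h
  rw [norm_toL1]
  exact h

/-- Right multiplication `F ↦ F K` on `L¹(vNa(Γ))` by an element `K` of `vNa(Γ)`, the extension by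
continuity of the multiplication of `vNa(Γ)`. -/
def mulRight (K : vNa Γ) : L1 Γ →L[ℂ] L1 Γ :=
  ((toL1 Γ).comp (LinearMap.mulRight ℂ K)).extendOfNorm (toL1 Γ)

theorem mulRight_toL1 (K F : vNa Γ) : mulRight K (toL1 Γ F) = toL1 Γ (F * K) := by
  refine LinearMap.extendOfNorm_eq denseRange_toL1 ⟨‖K.1‖, fun F => ?_⟩ F
  rw [norm_toL1, LinearMap.comp_apply, norm_toL1]
  exact norm1_mul_right_le F.2 K.2

/-- Left multiplication `F ↦ K F` on `L²(vNa(Γ))` by an element `K` of `vNa(Γ)`, the extension by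
continuity of the multiplication of `vNa(Γ)`. -/
def mulLeft (K : vNa Γ) : L2 Γ →L[ℂ] L2 Γ :=
  ((toL2 Γ).comp (LinearMap.mulLeft ℂ K)).extendOfNorm (toL2 Γ)

theorem mulLeft_toL2 (K F : vNa Γ) : mulLeft K (toL2 Γ F) = toL2 Γ (K * F) := by
  refine LinearMap.extendOfNorm_eq denseRange_toL2 ⟨‖K.1‖, fun F => ?_⟩ F
  rw [norm_toL2, LinearMap.comp_apply, norm_toL2]
  exact K.1.le_opNorm _

/-- For fixed `F` in `vNa(Γ)`, the map `G ↦ F G*` from `vNa(Γ)` to `L¹(vNa(Γ))`. -/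
def mulStarPre (F : vNa Γ) : vNa Γ →ₗ⋆[ℂ] L1 Γ where
  toFun G := toL1 Γ (F * star G)
  map_add' G K := by rw [star_add, mul_add, map_add]
  map_smul' c G := by rw [star_smul, mul_smul_comm, map_smul]; rfl

theorem norm_mulStarPre_le (F G : vNa Γ) : ‖mulStarPre F G‖ ≤ ‖toL2 Γ F‖ * ‖toL2 Γ G‖ := by
  rw [norm_toL2, norm_toL2]
  exact (norm_toL1 _).le.trans (norm1_mul_star_le F.2 G.2)

theorem mulStarPre_extend (F G : vNa Γ) :
    (mulStarPre F).extendOfNorm (toL2 Γ) (toL2 Γ G) = toL1 Γ (F * star G) :=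
  LinearMap.extendOfNorm_eq denseRange_toL2 ⟨_, norm_mulStarPre_le F⟩ G

theorem mulStarPre_smul_extend (c : ℂ) (F : vNa Γ) (x : L2 Γ) :
    (mulStarPre (c • F)).extendOfNorm (toL2 Γ) x
      = c • (mulStarPre F).extendOfNorm (toL2 Γ) x := by
  refine denseRange_toL2.induction_on x (isClosed_eq (ContinuousLinearMap.continuous _)
    ((ContinuousLinearMap.continuous _).const_smul c)) fun G => ?_
  rw [mulStarPre_extend, mulStarPre_extend, smul_mul_assoc, map_smul]

/-- For fixed `F` in `vNa(Γ)`, the map `G ↦ F G*` from `L²(vNa(Γ))` to `L¹(vNa(Γ))`. -/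
def mulStarAux : vNa Γ →ₗ[ℂ] L2 Γ →L⋆[ℂ] L1 Γ where
  toFun F := (mulStarPre F).extendOfNorm (toL2 Γ)
  map_add' F F' := by
    ext1 x
    refine denseRange_toL2.induction_on x (isClosed_eq (by fun_prop) (by fun_prop)) fun G => ?_
    rw [add_apply, mulStarPre_extend, mulStarPre_extend, mulStarPre_extend,
      add_mul, map_add]
  map_smul' c F := ContinuousLinearMap.ext fun x => mulStarPre_smul_extend c F x

variable (Γ) in
/-- The product `(F, G) ↦ F G*`, `L²(vNa(Γ)) × L²(vNa(Γ)) → L¹(vNa(Γ))`, the extension by continuity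
of the product of `vNa(Γ)`. -/
def mulStar : L2 Γ →L[ℂ] L2 Γ →L⋆[ℂ] L1 Γ := mulStarAux.extendOfNorm (toL2 Γ)

theorem mulStar_toL2 (F G : vNa Γ) :
    mulStar Γ (toL2 Γ F) (toL2 Γ G) = toL1 Γ (F * star G) := by
  have h : mulStar Γ (toL2 Γ F) = mulStarAux F := by
    refine LinearMap.extendOfNorm_eq denseRange_toL2 ⟨1, fun F => ?_⟩ F
    rw [one_mul]
    exact LinearMap.opNorm_extendOfNorm_le denseRange_toL2 (norm_nonneg _) (norm_mulStarPre_le F)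
  rw [h]
  exact mulStarPre_extend F G

end LpSpaces

section DualIntegrable

variable {Γ : Type*} [Group Γ] {H : Type*} [NormedAddCommGroup H] [InnerProductSpace ℂ H]

/-- The map `b : H × H → L¹(vNa(Γ))` is a bracket for the unitary representation `T` of `Γ` on `H`:
`⟨φ, T(γ) ψ⟩ = τ(b(φ, ψ) λ(γ)*)` for all `φ`, `ψ`, `γ`. Here `⟨·, ·⟩` is linear in the first
variable, that is, `⟨x, y⟩ = inner ℂ y x`. -/
def IsBracket (T : Γ →* (H ≃ₗᵢ[ℂ] H)) (b : H → H → L1 Γ) : Prop :=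
  ∀ (φ ψ : H) (γ : Γ), inner ℂ (T γ ψ) φ = trL1 Γ (mulRight (star (lamV γ)) (b φ ψ))

/-- The unitary representation `T` is dual integrable: it admits a bracket. -/
def DualIntegrable (T : Γ →* (H ≃ₗᵢ[ℂ] H)) : Prop := ∃ b : H → H → L1 Γ, IsBracket T b

end DualIntegrable

section Action

variable {Γ : Type*} [Group Γ] {X : Type*} [MeasurableSpace X] [MulAction Γ X]

/-- `J` is a Jacobian of the action of `Γ` on `(X, μ)`: a positive measurable function with
`μ(γ E) = ∫_E J(γ, x) dμ(x)` for all `γ` and all measurable `E`. The action is quasi-`Γ`-invariant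
when it has a Jacobian. -/
structure IsJacobian (μ : Measure X) (J : Γ → X → ℝ) : Prop where
  measurable : ∀ γ, Measurable (J γ)
  pos : ∀ γ x, 0 < J γ x
  measure_image : ∀ γ (E : Set X), MeasurableSet E →
    μ ((fun x => γ • x) '' E) = ∫⁻ x in E, ENNReal.ofReal (J γ x) ∂μ

variable (Γ) in
/-- `C` is a tiling set: `X` is, up to null sets, the disjoint union of the sets `γ C`. -/
structure IsTilingSet (μ : Measure X) (C : Set X) : Prop where
  nullMeasurableSet : NullMeasurableSet C μ
  measure_inter : ∀ γ₁ γ₂ : Γ, γ₁ ≠ γ₂ →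
    μ (((fun x => γ₁ • x) '' C) ∩ ((fun x => γ₂ • x) '' C)) = 0
  measure_compl : μ (⋃ γ : Γ, (fun x => γ • x) '' C)ᶜ = 0

/-- The formula `(γ, f) ↦ J(γ⁻¹, x)^{1/2} f(γ⁻¹ x)`. -/
def actFun (J : Γ → X → ℝ) (γ : Γ) (f : X → ℂ) (x : X) : ℂ :=
  (Real.sqrt (J γ⁻¹ x) : ℂ) * f (γ⁻¹ • x)

variable [MeasurableConstSMul Γ X] {μ : Measure X} {J : Γ → X → ℝ}

theorem IsJacobian.map_eq (hJ : IsJacobian μ J) (γ : Γ) :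
    μ.map (fun x => γ • x) = μ.withDensity fun x => ENNReal.ofReal (J γ⁻¹ x) := by
  ext E hE
  rw [Measure.map_apply (measurable_const_smul γ) hE, withDensity_apply _ hE,
    ← hJ.measure_image γ⁻¹ E hE]
  congr 1
  ext x
  constructor
  · intro hx
    exact ⟨γ • x, hx, inv_smul_smul γ x⟩
  · rintro ⟨y, hy, rfl⟩
    change γ • γ⁻¹ • y ∈ E
    rwa [smul_inv_smul]

theorem IsJacobian.quasi (hJ : IsJacobian μ J) (γ : Γ) :
    Measure.QuasiMeasurePreserving (fun x : X => γ • x) μ μ :=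
  ⟨measurable_const_smul γ, by rw [hJ.map_eq]; exact withDensity_absolutelyContinuous _ _⟩

/-- Change of variables. -/
theorem IsJacobian.lintegral_smul (hJ : IsJacobian μ J) (γ : Γ) {f : X → ENNReal}
    (hf : AEMeasurable f μ) :
    ∫⁻ x, f (γ • x) ∂μ = ∫⁻ x, ENNReal.ofReal (J γ⁻¹ x) * f x ∂μ := by
  have hac : μ.map (fun x => γ • x) ≪ μ := (hJ.quasi γ).absolutelyContinuous
  rw [← lintegral_map' (hf.mono_ac hac) (measurable_const_smul γ).aemeasurable, hJ.map_eq,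
    lintegral_withDensity_eq_lintegral_mul₀ (hJ.measurable _).ennreal_ofReal.aemeasurable hf]
  rfl

theorem IsJacobian.lintegral_actFun (hJ : IsJacobian μ J) (γ : Γ) {f : X → ℂ}
    (hf : AEStronglyMeasurable f μ) :
    ∫⁻ x, ‖actFun J γ f x‖ₑ ^ (2 : ℝ) ∂μ = ∫⁻ x, ‖f x‖ₑ ^ (2 : ℝ) ∂μ := by
  have h1 : ∀ x, ‖actFun J γ f x‖ₑ ^ (2 : ℝ)
      = ENNReal.ofReal (J γ⁻¹ x) * ‖f (γ⁻¹ • x)‖ₑ ^ (2 : ℝ) := by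
    intro x
    rw [actFun, enorm_mul, ENNReal.mul_rpow_of_nonneg _ _ (by norm_num)]
    congr 1
    rw [← ofReal_norm, Complex.norm_real, Real.norm_of_nonneg (Real.sqrt_nonneg _),
      ENNReal.ofReal_rpow_of_nonneg (Real.sqrt_nonneg _) (by norm_num), Real.rpow_two,
      Real.sq_sqrt (hJ.pos _ _).le]
  simp_rw [h1]
  have h2 : AEMeasurable (fun x => ‖f (γ⁻¹ • x)‖ₑ ^ (2 : ℝ)) μ :=
    ((hf.comp_quasiMeasurePreserving (hJ.quasi γ⁻¹)).enorm).pow_const _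
  rw [← hJ.lintegral_smul γ h2]
  simp_rw [inv_smul_smul]

theorem IsJacobian.memLp_actFun (hJ : IsJacobian μ J) (γ : Γ) {f : X → ℂ} (hf : MemLp f 2 μ) :
    MemLp (actFun J γ f) 2 μ := by
  refine ⟨?_, ?_⟩
  · refine AEStronglyMeasurable.mul ?_ (hf.1.comp_quasiMeasurePreserving (hJ.quasi γ⁻¹))
    exact (Complex.measurable_ofReal.comp (hJ.measurable γ⁻¹).sqrt).aestronglyMeasurable
  · have h := hf.2
    rw [eLpNorm_lt_top_iff_lintegral_rpow_enorm_lt_top (by norm_num) (by norm_num)] at h ⊢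
    simp only [ENNReal.toReal_ofNat] at h ⊢
    rwa [hJ.lintegral_actFun γ hf.1]

theorem IsJacobian.eLpNorm_actFun (hJ : IsJacobian μ J) (γ : Γ) {f : X → ℂ} (hf : MemLp f 2 μ) :
    eLpNorm (actFun J γ f) 2 μ = eLpNorm f 2 μ := by
  rw [eLpNorm_eq_lintegral_rpow_enorm_toReal (by norm_num) (by norm_num),
    eLpNorm_eq_lintegral_rpow_enorm_toReal (by norm_num) (by norm_num)]
  simp only [ENNReal.toReal_ofNat]
  rw [hJ.lintegral_actFun γ hf.1]

theorem IsJacobian.actFun_congr (hJ : IsJacobian μ J) (γ : Γ) {f g : X → ℂ} (h : f =ᵐ[μ] g) :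
    actFun J γ f =ᵐ[μ] actFun J γ g := by
  filter_upwards [(hJ.quasi γ⁻¹).ae_eq_comp h] with x hx
  simp only [Function.comp_apply] at hx
  rw [actFun, actFun, hx]

/-- The chain rule for the Jacobian. -/
theorem IsJacobian.chain [SigmaFinite μ] (hJ : IsJacobian μ J) (γ₁ γ₂ : Γ) :
    ∀ᵐ x ∂μ, J (γ₁ * γ₂) x = J γ₁ (γ₂ • x) * J γ₂ x := by
  have hm : Measurable fun x => ENNReal.ofReal (J γ₁ (γ₂ • x) * J γ₂ x) :=
    (((hJ.measurable γ₁).comp (measurable_const_smul γ₂)).mul (hJ.measurable γ₂)).ennreal_ofReal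
  have h : (fun x => ENNReal.ofReal (J (γ₁ * γ₂) x)) =ᵐ[μ]
      fun x => ENNReal.ofReal (J γ₁ (γ₂ • x) * J γ₂ x) := by
    refine ae_eq_of_forall_setLIntegral_eq_of_sigmaFinite
      (hJ.measurable _).ennreal_ofReal hm fun E hE _ => ?_
    have himg : (fun x => γ₂ • x) '' E = (fun x => γ₂⁻¹ • x) ⁻¹' E := by
      ext x
      constructor
      · rintro ⟨y, hy, rfl⟩
        change γ₂⁻¹ • γ₂ • y ∈ E
        rwa [inv_smul_smul]
      · intro hx
        exact ⟨γ₂⁻¹ • x, hx, smul_inv_smul γ₂ x⟩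
    have hE' : MeasurableSet ((fun x => γ₂ • x) '' E) := by
      rw [himg]; exact measurable_const_smul γ₂⁻¹ hE
    have h1 : (fun x => (γ₁ * γ₂) • x) '' E = (fun x => γ₁ • x) '' ((fun x => γ₂ • x) '' E) := by
      rw [Set.image_image]
      simp_rw [mul_smul]
    rw [← hJ.measure_image _ E hE, h1, hJ.measure_image _ _ hE']
    have h2 : ∀ x, ((fun x => γ₂ • x) '' E).indicator (fun x => ENNReal.ofReal (J γ₁ x)) x
        = E.indicator (fun y => ENNReal.ofReal (J γ₁ (γ₂ • y))) (γ₂⁻¹ • x) := by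
      intro x
      rw [himg]
      by_cases hx : γ₂⁻¹ • x ∈ E
      · rw [Set.indicator_of_mem hx, Set.indicator_of_mem (show x ∈ _ ⁻¹' E from hx),
          smul_inv_smul]
      · rw [Set.indicator_of_notMem hx, Set.indicator_of_notMem (show x ∉ _ ⁻¹' E from hx)]
    rw [← lintegral_indicator hE']
    simp_rw [h2]
    have hm' : Measurable fun x => J γ₁ (γ₂ • x) :=
      (hJ.measurable γ₁).comp (measurable_const_smul γ₂)
    rw [hJ.lintegral_smul γ₂⁻¹ (hm'.ennreal_ofReal.indicator hE).aemeasurable,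
      ← lintegral_indicator hE]
    refine lintegral_congr fun x => ?_
    rw [inv_inv]
    by_cases hx : x ∈ E
    · rw [Set.indicator_of_mem hx, Set.indicator_of_mem hx, mul_comm,
        ← ENNReal.ofReal_mul (hJ.pos _ _).le]
    · rw [Set.indicator_of_notMem hx, Set.indicator_of_notMem hx, mul_zero]
  filter_upwards [h] with x hx
  rwa [ENNReal.ofReal_eq_ofReal_iff (hJ.pos _ _).le
    (mul_pos (hJ.pos _ _) (hJ.pos _ _)).le] at hx

theorem IsJacobian.one [SigmaFinite μ] (hJ : IsJacobian μ J) : ∀ᵐ x ∂μ, J 1 x = 1 := by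
  filter_upwards [hJ.chain 1 1] with x hx
  rw [one_mul, one_smul] at hx
  nlinarith [hJ.pos 1 x]

theorem IsJacobian.actFun_one [SigmaFinite μ] (hJ : IsJacobian μ J) (f : X → ℂ) :
    actFun J 1 f =ᵐ[μ] f := by
  filter_upwards [hJ.one] with x hx
  rw [actFun, inv_one, hx, one_smul, Real.sqrt_one, Complex.ofReal_one, one_mul]

theorem IsJacobian.actFun_actFun [SigmaFinite μ] (hJ : IsJacobian μ J) (γ₁ γ₂ : Γ) (f : X → ℂ) :
    actFun J γ₁ (actFun J γ₂ f) =ᵐ[μ] actFun J (γ₁ * γ₂) f := by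
  filter_upwards [hJ.chain γ₂⁻¹ γ₁⁻¹] with x hx
  rw [actFun, actFun, actFun, mul_inv_rev, hx, Real.sqrt_mul (hJ.pos _ _).le, mul_smul,
    Complex.ofReal_mul]
  ring

/-- `T_σ(γ)` as a linear isometry of `L²(X, μ)`. -/
def repIsometry (hJ : IsJacobian μ J) (γ : Γ) : Lp ℂ 2 μ →ₗᵢ[ℂ] Lp ℂ 2 μ where
  toFun f := (hJ.memLp_actFun γ (Lp.memLp f)).toLp
  map_add' f g := by
    rw [← MemLp.toLp_add]
    refine MemLp.toLp_congr _ _ ((hJ.actFun_congr γ (Lp.coeFn_add f g)).trans (.of_forall ?_))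
    intro x
    simp only [actFun, Pi.add_apply, mul_add]
  map_smul' c f := by
    rw [RingHom.id_apply, ← MemLp.toLp_const_smul]
    refine MemLp.toLp_congr _ _ ((hJ.actFun_congr γ (Lp.coeFn_smul c f)).trans (.of_forall ?_))
    intro x
    simp only [actFun, Pi.smul_apply, smul_eq_mul]
    ring
  norm_map' f := by
    change ‖(hJ.memLp_actFun γ (Lp.memLp f)).toLp‖ = ‖f‖
    rw [Lp.norm_toLp, hJ.eLpNorm_actFun γ (Lp.memLp f), Lp.norm_def]

theorem coeFn_repIsometry (hJ : IsJacobian μ J) (γ : Γ) (f : Lp ℂ 2 μ) :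
    repIsometry hJ γ f =ᵐ[μ] actFun J γ f :=
  MemLp.coeFn_toLp (hJ.memLp_actFun γ (Lp.memLp f))

theorem repIsometry_comp [SigmaFinite μ] (hJ : IsJacobian μ J) (γ₁ γ₂ : Γ) (f : Lp ℂ 2 μ) :
    repIsometry hJ γ₁ (repIsometry hJ γ₂ f) = repIsometry hJ (γ₁ * γ₂) f :=
  Lp.ext <| (coeFn_repIsometry hJ γ₁ _).trans <|
    (hJ.actFun_congr γ₁ (coeFn_repIsometry hJ γ₂ f)).trans <|
    (hJ.actFun_actFun γ₁ γ₂ f).trans (coeFn_repIsometry hJ _ f).symm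

theorem repIsometry_one [SigmaFinite μ] (hJ : IsJacobian μ J) (f : Lp ℂ 2 μ) :
    repIsometry hJ 1 f = f :=
  Lp.ext <| (coeFn_repIsometry hJ 1 _).trans (hJ.actFun_one f)

/-- The unitary representation `T_σ` of `Γ` on `L²(X, μ)` associated to the action:
`T_σ(γ) ψ (x) = J(γ⁻¹, x)^{1/2} ψ(γ⁻¹ x)`. -/
def repSigma [SigmaFinite μ] (hJ : IsJacobian μ J) : Γ →* (Lp ℂ 2 μ ≃ₗᵢ[ℂ] Lp ℂ 2 μ) where
  toFun γ :=
    { toLinearEquiv := LinearEquiv.ofLinearMap (repIsometry hJ γ).toLinearMap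
        (repIsometry hJ γ⁻¹).toLinearMap
        (by ext1 f; simp [repIsometry_comp, repIsometry_one])
        (by ext1 f; simp [repIsometry_comp, repIsometry_one])
      norm_map' := (repIsometry hJ γ).norm_map }
  map_one' := by ext1 f; exact repIsometry_one hJ f
  map_mul' γ γ' := by ext1 f; exact (repIsometry_comp hJ γ γ' f).symm

theorem coeFn_repSigma [SigmaFinite μ] (hJ : IsJacobian μ J) (γ : Γ) (f : Lp ℂ 2 μ) :
    repSigma hJ γ f =ᵐ[μ] fun x => (Real.sqrt (J γ⁻¹ x) : ℂ) * f (γ⁻¹ • x) :=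
  coeFn_repIsometry hJ γ f

/-- The terms `(T_σ(γ) ψ)(x) λ(γ)*` of the series that defines the Zak transform at `x`, as elements
of `L²(vNa(Γ))`. -/
def zakTerm (J : Γ → X → ℝ) (ψ : X → ℂ) (x : X) (γ : Γ) : L2 Γ :=
  actFun J γ ψ x • toL2 Γ (star (lamV γ))

/-- The noncommutative Zak transform `Z_σ[ψ](x) = ∑_γ (T_σ(γ) ψ)(x) λ(γ)*`, the sum of a series in
`L²(vNa(Γ))`. -/
def zak (J : Γ → X → ℝ) (ψ : X → ℂ) (x : X) : L2 Γ := ∑' γ, zakTerm J ψ x γ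

end Action

end NCZak

end

open NCZak

namespace NCZak

/-! The operators `λ(γ)*` form an orthonormal family in `L²(vNa(Γ))`, because `λ(γ)δ_e = δ_γ`. At a
fixed `x` the Zak series is therefore an orthonormal expansion with coefficients `(T_σ(γ)ψ)(x)`: it
converges exactly when these are square summable, and the squared norm of its sum is then the sum of
their squares.

The coefficients satisfy `|(T_σ(γ)ψ)(x)|² = J(γ⁻¹, x)|ψ(γ⁻¹x)|²`. Since the tiles `γC` fill `X` up
to null sets, a change of variables on each tile shows that the sum over `γ`, integrated over `C`,
equals `∫_X |ψ|²` (`IsTilingSet.lintegral_tsum_actFun`). This gives convergence almost everywhere on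
`C` and the isometry; convergence spreads from `C` to `X` along orbits.

Left multiplication by `λ(g)` permutes the orthonormal family, and reindexing the series gives
quasi-periodicity. Traciality gives `τ(F G* K) = ⟨F, K* G⟩` for `F`, `G` in `L²(vNa(Γ))` and `K` in
`vNa(Γ)` (`trL1_mulRight_mulStar`). With `K = λ(γ)*` the right side at `x` is `⟨Z[φ](x),
Z[T_σ(γ)ψ](x)⟩`, and integrating over `C` gives `⟨φ, T_σ(γ)ψ⟩` by the isometry. -/

theorem enorm_rpow_two {E : Type*} [SeminormedAddCommGroup E] (v : E) :
    ‖v‖ₑ ^ (2 : ℝ) = ENNReal.ofReal (‖v‖ ^ 2) := by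
  rw [← ofReal_norm, ENNReal.ofReal_rpow_of_nonneg (norm_nonneg _) (by norm_num), Real.rpow_two]

/-! ### The orthonormal family `λ(γ)*` in `L²(vNa(Γ))`, and the trace of a product. -/

section GroupBasis

variable {Γ : Type*} [Group Γ]

theorem tau_lam [DecidableEq Γ] (γ : Γ) : tau Γ (lam γ) = if γ = 1 then 1 else 0 := by
  rw [tau_apply, lam_apply, leftReg_delta, mul_one, inner_delta, delta_apply]
  simp only [eq_comm]

theorem star_lamV (γ : Γ) : star (lamV γ) = lamV γ⁻¹ := Subtype.ext (star_lam γ)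

theorem lamV_mul (γ γ' : Γ) : lamV γ * lamV γ' = lamV (γ * γ') := Subtype.ext (lam_mul γ γ')

variable (Γ) in
-- The inner product of two members is `τ(λ(γ γ'⁻¹))`, which is `1` or `0` according to whether `γ =
-- γ'`. Only orthonormality is needed below, not completeness of the family.
theorem orthonormal_toL2_star_lamV : Orthonormal ℂ fun γ : Γ => toL2 Γ (star (lamV γ)) := by
  classical
  rw [orthonormal_iff_ite]
  intro γ γ'
  simp only [star_lamV]
  rw [inner_toL2]
  change tau Γ (star (lam γ⁻¹) * lam γ'⁻¹) = _
  rw [star_lam, inv_inv, lam_mul, tau_lam]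
  simp only [mul_inv_eq_one]

/-- Left multiplication by `λ(g)` permutes the orthonormal family; this is the source of
quasi-periodicity. -/
theorem mulLeft_lamV_toL2_star (g γ : Γ) :
    mulLeft (lamV g) (toL2 Γ (star (lamV γ))) = toL2 Γ (star (lamV (γ * g⁻¹))) := by
  rw [mulLeft_toL2, star_lamV, star_lamV, lamV_mul, mul_inv_rev, inv_inv]

theorem norm_mulStar_le (F G : L2 Γ) : ‖mulStar Γ F G‖ ≤ ‖mulStar Γ‖ * ‖F‖ * ‖G‖ :=
  ContinuousLinearMap.le_opNorm₂ (mulStar Γ) F G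

/-- Joint continuity follows from boundedness by splitting `F G* - F₀ G₀*` as `(F - F₀) G* + F₀ (G -
G₀)*`. It serves both the density argument for the trace formula and the measurability of the
bracket integrand. -/
theorem continuous_mulStar : Continuous fun p : L2 Γ × L2 Γ => mulStar Γ p.1 p.2 := by
  refine continuous_iff_continuousAt.mpr fun q => ?_
  refine tendsto_iff_norm_sub_tendsto_zero.mpr ?_
  refine squeeze_zero (g := fun p : L2 Γ × L2 Γ =>
    ‖mulStar Γ‖ * ‖p.1 - q.1‖ * ‖p.2‖ + ‖mulStar Γ‖ * ‖q.1‖ * ‖p.2 - q.2‖)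
    (fun _ => norm_nonneg _) (fun p => ?_) ?_
  · have h : mulStar Γ p.1 p.2 - mulStar Γ q.1 q.2
        = mulStar Γ (p.1 - q.1) p.2 + mulStar Γ q.1 (p.2 - q.2) := by
      rw [map_sub, map_sub, sub_apply, sub_add_sub_cancel]
    rw [h]
    exact (norm_add_le _ _).trans (add_le_add (norm_mulStar_le _ _) (norm_mulStar_le _ _))
  · have hc : Continuous fun p : L2 Γ × L2 Γ =>
        ‖mulStar Γ‖ * ‖p.1 - q.1‖ * ‖p.2‖ + ‖mulStar Γ‖ * ‖q.1‖ * ‖p.2 - q.2‖ := by fun_prop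
    simpa using hc.tendsto q

/-- The trace of a product `F G* K` as an inner product in `L²(vNa(Γ))`. -/
theorem trL1_mulRight_mulStar (K : vNa Γ) (F G : L2 Γ) :
    trL1 Γ (mulRight K (mulStar Γ F G)) = inner ℂ (mulLeft (star K) G) F := by
  refine denseRange_toL2.induction_on₂ (p := fun F G => trL1 Γ (mulRight K (mulStar Γ F G)) =
    inner ℂ (mulLeft (star K) G) F) (isClosed_eq ?_ ?_) (fun F G => ?_) F G
  · exact (trL1 Γ).continuous.comp ((mulRight K).continuous.comp continuous_mulStar)
  · exact ((mulLeft (star K)).continuous.comp continuous_snd).inner continuous_fst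
  · rw [mulStar_toL2, mulRight_toL1, trL1_toL1, mulLeft_toL2, inner_toL2]
    change tau Γ (F.1 * star G.1 * K.1) = tau Γ (star (star K.1 * G.1) * F.1)
    -- On the dense subspace `vNa(Γ)` the identity is traciality, which moves `F` across `G* K = (K*
    -- G)*`.
    rw [star_mul, star_star, mul_assoc,
      tau_mul_comm F.2 ((vNa Γ).mul_mem ((vNa Γ).star_mem' G.2) K.2)]

end GroupBasis

/-! ### Unfolding integrals over the tiles `γC`. -/

section Tiling

variable {Γ : Type*} [Group Γ] {X : Type*} [MulAction Γ X]

theorem image_smul_eq_preimage_inv_smul (γ : Γ) (E : Set X) :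
    (fun x => γ • x) '' E = (fun x => γ⁻¹ • x) ⁻¹' E := by
  ext x
  constructor
  · rintro ⟨y, hy, rfl⟩
    change γ⁻¹ • γ • y ∈ E
    rwa [inv_smul_smul]
  · intro hx
    exact ⟨γ⁻¹ • x, hx, smul_inv_smul γ x⟩

variable [MeasurableSpace X] [MeasurableConstSMul Γ X] {μ : Measure X} {J : Γ → X → ℝ} {C : Set X}

theorem IsJacobian.nullMeasurableSet_image (hJ : IsJacobian μ J) (γ : Γ) {E : Set X}
    (hE : NullMeasurableSet E μ) : NullMeasurableSet ((fun x => γ • x) '' E) μ := by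
  rw [image_smul_eq_preimage_inv_smul]
  exact hE.preimage (hJ.quasi γ⁻¹)

/-- Change of variables applied to an indicator: `x` lies in `γE` exactly when `γ⁻¹x` lies in `E`.
Null measurability of `E` is all that a tiling set provides. -/
theorem IsJacobian.setLIntegral_image (hJ : IsJacobian μ J) (γ : Γ) {E : Set X}
    (hE : NullMeasurableSet E μ) {f : X → ENNReal} (hf : AEMeasurable f μ) :
    ∫⁻ x in (fun x => γ • x) '' E, f x ∂μ
      = ∫⁻ x in E, ENNReal.ofReal (J γ x) * f (γ • x) ∂μ := by
  have h : ∀ x, ((fun x => γ • x) '' E).indicator f x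
      = E.indicator (fun y => f (γ • y)) (γ⁻¹ • x) := by
    intro x
    rw [image_smul_eq_preimage_inv_smul]
    by_cases hx : γ⁻¹ • x ∈ E
    · rw [Set.indicator_of_mem hx, Set.indicator_of_mem (show x ∈ _ ⁻¹' E from hx), smul_inv_smul]
    · rw [Set.indicator_of_notMem hx, Set.indicator_of_notMem (show x ∉ _ ⁻¹' E from hx)]
  have hf' : AEMeasurable (fun y => f (γ • y)) μ := hf.comp_quasiMeasurePreserving (hJ.quasi γ)
  rw [← lintegral_indicator₀ (hJ.nullMeasurableSet_image γ hE)]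
  simp_rw [h]
  rw [hJ.lintegral_smul γ⁻¹ (hf'.indicator₀ hE), ← lintegral_indicator₀ hE]
  refine lintegral_congr fun x => ?_
  rw [inv_inv]
  by_cases hx : x ∈ E
  · rw [Set.indicator_of_mem hx, Set.indicator_of_mem hx]
  · rw [Set.indicator_of_notMem hx, Set.indicator_of_notMem hx, mul_zero]

variable [Countable Γ]

/-- Integration over `X` unfolds to integration over a tiling set. -/
theorem IsTilingSet.lintegral_eq_tsum (hC : IsTilingSet Γ μ C) (hJ : IsJacobian μ J)
    {f : X → ENNReal} (hf : AEMeasurable f μ) :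
    ∫⁻ x, f x ∂μ = ∑' γ : Γ, ∫⁻ x in C, ENNReal.ofReal (J γ x) * f (γ • x) ∂μ := by
  simp_rw [← hJ.setLIntegral_image _ hC.nullMeasurableSet hf]
  -- Countable additivity requires the tiles to be disjoint and measurable only up to null sets.
  rw [← lintegral_iUnion₀ (fun γ => hJ.nullMeasurableSet_image γ hC.nullMeasurableSet)
    (fun γ₁ γ₂ h => hC.measure_inter γ₁ γ₂ h)]
  have huniv : (⋃ γ : Γ, (fun x => γ • x) '' C) =ᵐ[μ] Set.univ :=
    ae_eq_univ.mpr hC.measure_compl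
  rw [setLIntegral_congr huniv, setLIntegral_univ]

/-- A property that holds almost everywhere on the tiling set and is invariant under the action
holds almost everywhere. -/
theorem IsTilingSet.ae_of_ae_restrict (hC : IsTilingSet Γ μ C) (hJ : IsJacobian μ J)
    {p : X → Prop} (h : ∀ᵐ x ∂μ.restrict C, p x) (hp : ∀ γ : Γ, ∀ᵐ x ∂μ, p (γ⁻¹ • x) → p x) :
    ∀ᵐ x ∂μ, p x := by
  have h1 : ∀ᵐ x ∂μ, x ∈ C → p x := (ae_restrict_iff'₀ hC.nullMeasurableSet).mp h
  -- Each translation pulls null sets back to null sets, and `Γ` is countable, so one null set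
  -- serves all `γ`.
  have h2 : ∀ᵐ x ∂μ, ∀ γ : Γ, γ⁻¹ • x ∈ C → p (γ⁻¹ • x) :=
    ae_all_iff.mpr fun γ => (hJ.quasi γ⁻¹).ae h1
  have h3 : ∀ᵐ x ∂μ, x ∈ ⋃ γ : Γ, (fun x => γ • x) '' C := hC.measure_compl
  filter_upwards [h2, h3, ae_all_iff.mpr hp] with x hx2 hx3 hx4
  obtain ⟨γ, hγ⟩ := Set.mem_iUnion.mp hx3
  rw [image_smul_eq_preimage_inv_smul] at hγ
  exact hx4 γ (hx2 γ hγ)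

/-- The square of the factor `J(γ⁻¹, x)^{1/2}` is precisely the density in the unfolding formula,
with `γ` replaced by `γ⁻¹`. Both almost everywhere convergence and the isometry rest on this
identity. -/
theorem IsTilingSet.lintegral_tsum_actFun (hC : IsTilingSet Γ μ C) (hJ : IsJacobian μ J)
    {f : X → ℂ} (hf : AEStronglyMeasurable f μ) :
    ∫⁻ x in C, ∑' γ : Γ, ‖actFun J γ f x‖ₑ ^ (2 : ℝ) ∂μ = ∫⁻ x, ‖f x‖ₑ ^ (2 : ℝ) ∂μ := by
  have h1 : ∀ γ x, ‖actFun J γ f x‖ₑ ^ (2 : ℝ)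
      = ENNReal.ofReal (J γ⁻¹ x) * ‖f (γ⁻¹ • x)‖ₑ ^ (2 : ℝ) := by
    intro γ x
    rw [actFun, enorm_mul, ENNReal.mul_rpow_of_nonneg _ _ (by norm_num), enorm_rpow_two,
      Complex.norm_real, Real.norm_of_nonneg (Real.sqrt_nonneg _), Real.sq_sqrt (hJ.pos _ _).le]
  have hf2 : AEMeasurable (fun x => ‖f x‖ₑ ^ (2 : ℝ)) μ := hf.enorm.pow_const _
  have hm : ∀ γ : Γ, AEMeasurable
      (fun x => ENNReal.ofReal (J γ⁻¹ x) * ‖f (γ⁻¹ • x)‖ₑ ^ (2 : ℝ)) μ := fun γ =>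
    (hJ.measurable γ⁻¹).ennreal_ofReal.aemeasurable.mul
      (hf2.comp_quasiMeasurePreserving (hJ.quasi γ⁻¹))
  simp_rw [h1]
  rw [lintegral_tsum fun γ => (hm γ).restrict, hC.lintegral_eq_tsum hJ hf2]
  exact (Equiv.inv Γ).tsum_eq fun γ => ∫⁻ x in C, ENNReal.ofReal (J γ x) * ‖f (γ • x)‖ₑ ^ (2 : ℝ) ∂μ

end Tiling

/-! ### The Zak transform: convergence, isometry, quasi-periodicity and bracket. -/

section Zak

variable {Γ : Type*} [Group Γ] {X : Type*} [MulAction Γ X] {J : Γ → X → ℝ}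

theorem summable_zakTerm_iff {ψ : X → ℂ} {x : X} :
    Summable (zakTerm J ψ x) ↔ Summable fun γ => ‖actFun J γ ψ x‖ ^ 2 :=
  (orthonormal_toL2_star_lamV Γ).orthogonalFamily.summable_iff_norm_sq_summable
    fun γ => actFun J γ ψ x

theorem inner_toL2_star_lamV_zak {ψ : X → ℂ} {x : X} (h : Summable (zakTerm J ψ x)) (γ : Γ) :
    inner ℂ (toL2 Γ (star (lamV γ))) (zak J ψ x) = actFun J γ ψ x := by
  classical
  have h1 := h.hasSum.mapL (innerSL ℂ (toL2 Γ (star (lamV γ))))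
  have h2 : ∀ γ', innerSL ℂ (toL2 Γ (star (lamV γ))) (zakTerm J ψ x γ')
      = if γ' = γ then actFun J γ ψ x else 0 := by
    intro γ'
    rw [innerSL_apply_apply, zakTerm, inner_smul_right,
      orthonormal_iff_ite.mp (orthonormal_toL2_star_lamV Γ)]
    by_cases hγ : γ = γ'
    · subst hγ; simp
    · simp [hγ, Ne.symm hγ]
  simp_rw [h2] at h1
  exact h1.unique (hasSum_ite_eq γ (actFun J γ ψ x))

/-- Parseval: pair the convergent series with its own sum, whose coefficients are known from
`inner_toL2_star_lamV_zak`. -/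
theorem hasSum_norm_zak_sq {ψ : X → ℂ} {x : X} (h : Summable (zakTerm J ψ x)) :
    HasSum (fun γ => ‖actFun J γ ψ x‖ ^ 2) (‖zak J ψ x‖ ^ 2) := by
  have h1 := h.hasSum.mapL (innerSL ℂ (zak J ψ x))
  have h2 : ∀ γ, innerSL ℂ (zak J ψ x) (zakTerm J ψ x γ) = ((‖actFun J γ ψ x‖ ^ 2 : ℝ) : ℂ) := by
    intro γ
    rw [innerSL_apply_apply, zakTerm, inner_smul_right, ← inner_conj_symm,
      inner_toL2_star_lamV_zak h, Complex.mul_conj, Complex.normSq_eq_norm_sq]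
  simp_rw [h2] at h1
  have h3 : innerSL ℂ (zak J ψ x) (∑' γ, zakTerm J ψ x γ) = ((‖zak J ψ x‖ ^ 2 : ℝ) : ℂ) := by
    rw [innerSL_apply_apply]
    exact (inner_self_eq_norm_sq_to_K (𝕜 := ℂ) (zak J ψ x)).trans (by norm_cast)
  rw [h3] at h1
  exact Complex.hasSum_ofReal.mp h1

theorem enorm_zak_sq {ψ : X → ℂ} {x : X} (h : Summable (zakTerm J ψ x)) :
    ‖zak J ψ x‖ₑ ^ (2 : ℝ) = ∑' γ, ‖actFun J γ ψ x‖ₑ ^ (2 : ℝ) := by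
  have h1 := hasSum_norm_zak_sq h
  simp_rw [enorm_rpow_two]
  rw [← h1.tsum_eq, ENNReal.ofReal_tsum_of_nonneg (fun _ => by positivity) h1.summable]

theorem zak_congr {φ ψ : X → ℂ} {x : X} (h : ∀ γ, actFun J γ φ x = actFun J γ ψ x) :
    zak J φ x = zak J ψ x := by
  simp only [zak, zakTerm, h]

theorem zak_add {φ ψ : X → ℂ} {x : X} (hφ : Summable (zakTerm J φ x))
    (hψ : Summable (zakTerm J ψ x)) : zak J (φ + ψ) x = zak J φ x + zak J ψ x := by
  rw [zak, zak, zak, ← hφ.tsum_add hψ]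
  simp only [zakTerm, actFun, Pi.add_apply, mul_add, add_smul]

theorem zak_smul (c : ℂ) {ψ : X → ℂ} {x : X} (hψ : Summable (zakTerm J ψ x)) :
    zak J (c • ψ) x = c • zak J ψ x := by
  rw [zak, zak, ← hψ.tsum_const_smul c]
  simp only [zakTerm, actFun, Pi.smul_apply, smul_eq_mul, smul_smul, mul_left_comm c]

variable [MeasurableSpace X] [MeasurableConstSMul Γ X] {μ : Measure X} {C : Set X} [Countable Γ]

/-- The value at `x` involves the function on the whole orbit of `x`; countability of `Γ` keeps the
exceptional set null. This makes the transform well defined on classes in `L²`. -/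
theorem IsJacobian.zak_congr_ae (hJ : IsJacobian μ J) {φ ψ : X → ℂ} (h : φ =ᵐ[μ] ψ) :
    zak J φ =ᵐ[μ] zak J ψ := by
  filter_upwards [ae_all_iff.mpr fun γ => hJ.actFun_congr γ h] with x hx
  exact zak_congr hx

theorem IsTilingSet.ae_summable_zakTerm [SigmaFinite μ] (hC : IsTilingSet Γ μ C)
    (hJ : IsJacobian μ J) {ψ : X → ℂ} (hψ : MemLp ψ 2 μ) :
    ∀ᵐ x ∂μ, Summable (zakTerm J ψ x) := by
  simp_rw [summable_zakTerm_iff]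
  refine hC.ae_of_ae_restrict hJ ?_ fun g => ?_
  · have hfin : ∫⁻ x in C, ∑' γ : Γ, ‖actFun J γ ψ x‖ₑ ^ (2 : ℝ) ∂μ ≠ ⊤ := by
      rw [hC.lintegral_tsum_actFun hJ hψ.1]
      have h := hψ.2
      rw [eLpNorm_lt_top_iff_lintegral_rpow_enorm_lt_top (by norm_num) (by norm_num)] at h
      simpa using h.ne
    have hm : AEMeasurable (fun x => ∑' γ : Γ, ‖actFun J γ ψ x‖ₑ ^ (2 : ℝ)) (μ.restrict C) :=
      AEMeasurable.tsum fun γ => ((hJ.memLp_actFun γ hψ).1.enorm.pow_const _).restrict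
    filter_upwards [ae_lt_top' hm hfin] with x hx
    have h := ENNReal.summable_toReal hx.ne
    refine h.congr fun γ => ?_
    rw [← ENNReal.toReal_rpow, toReal_enorm, Real.rpow_two]
  -- Along orbits: the series of squares at `g⁻¹x`, multiplied by `J(g⁻¹, x)`, is the series at `x`
  -- reindexed by `γ ↦ gγ`.
  · filter_upwards [ae_all_iff.mpr fun γ => hJ.actFun_actFun g γ ψ] with x hx hs
    have h := (hs.mul_left (J g⁻¹ x))
    have h' : Summable fun γ => ‖actFun J (g * γ) ψ x‖ ^ 2 := by
      refine h.congr fun γ => ?_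
      rw [← hx γ, actFun.eq_def J g, norm_mul, mul_pow, Complex.norm_real,
        Real.norm_of_nonneg (Real.sqrt_nonneg _), Real.sq_sqrt (hJ.pos _ _).le]
    exact (Equiv.mulLeft g).summable_iff.mp h'

theorem IsTilingSet.aestronglyMeasurable_zak [SigmaFinite μ] (hC : IsTilingSet Γ μ C)
    (hJ : IsJacobian μ J) {ψ : X → ℂ} (hψ : MemLp ψ 2 μ) : AEStronglyMeasurable (zak J ψ) μ := by
  refine aestronglyMeasurable_of_tendsto_ae (Filter.atTop : Filter (Finset Γ))
    (f := fun s x => ∑ γ ∈ s, zakTerm J ψ x γ) (fun s => ?_) ?_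
  · refine Finset.aestronglyMeasurable_fun_sum s fun γ _ => ?_
    exact (hJ.memLp_actFun γ hψ).1.smul_const _
  · filter_upwards [hC.ae_summable_zakTerm hJ hψ] with x hx
    exact hx.hasSum

/-- Parseval at almost every `x`, integrated over `C` and unfolded to `X`. -/
theorem IsTilingSet.eLpNorm_zak [SigmaFinite μ] (hC : IsTilingSet Γ μ C)
    (hJ : IsJacobian μ J) {ψ : X → ℂ} (hψ : MemLp ψ 2 μ) :
    eLpNorm (zak J ψ) 2 (μ.restrict C) = eLpNorm ψ 2 μ := by
  rw [eLpNorm_eq_lintegral_rpow_enorm_toReal (by norm_num) (by norm_num),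
    eLpNorm_eq_lintegral_rpow_enorm_toReal (by norm_num) (by norm_num)]
  simp only [ENNReal.toReal_ofNat]
  rw [← hC.lintegral_tsum_actFun hJ hψ.1]
  congr 1
  refine lintegral_congr_ae ?_
  filter_upwards [ae_restrict_of_ae (hC.ae_summable_zakTerm hJ hψ)] with x hx
  exact enorm_zak_sq hx

theorem IsTilingSet.memLp_zak [SigmaFinite μ] (hC : IsTilingSet Γ μ C)
    (hJ : IsJacobian μ J) {ψ : X → ℂ} (hψ : MemLp ψ 2 μ) : MemLp (zak J ψ) 2 (μ.restrict C) :=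
  ⟨(hC.aestronglyMeasurable_zak hJ hψ).restrict, by rw [hC.eLpNorm_zak hJ hψ]; exact hψ.2⟩

/-- The noncommutative Zak transform as a linear isometry. -/
noncomputable def zakIsometry [SigmaFinite μ] (hC : IsTilingSet Γ μ C) (hJ : IsJacobian μ J) :
    Lp ℂ 2 μ →ₗᵢ[ℂ] Lp (L2 Γ) 2 (μ.restrict C) where
  toFun ψ := (hC.memLp_zak hJ (Lp.memLp ψ)).toLp
  map_add' φ ψ := by
    rw [← MemLp.toLp_add]
    refine MemLp.toLp_congr _ _ (ae_restrict_of_ae ?_)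
    filter_upwards [hJ.zak_congr_ae (Lp.coeFn_add φ ψ), hC.ae_summable_zakTerm hJ (Lp.memLp φ),
      hC.ae_summable_zakTerm hJ (Lp.memLp ψ)] with x h hφ hψ
    rw [h, zak_add hφ hψ, Pi.add_apply]
  map_smul' c ψ := by
    rw [RingHom.id_apply, ← MemLp.toLp_const_smul]
    refine MemLp.toLp_congr _ _ (ae_restrict_of_ae ?_)
    filter_upwards [hJ.zak_congr_ae (Lp.coeFn_smul c ψ),
      hC.ae_summable_zakTerm hJ (Lp.memLp ψ)] with x h hψ
    rw [h, zak_smul c hψ, Pi.smul_apply]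
  norm_map' ψ := by
    change ‖(hC.memLp_zak hJ (Lp.memLp ψ)).toLp‖ = ‖ψ‖
    rw [Lp.norm_toLp, hC.eLpNorm_zak hJ (Lp.memLp ψ), Lp.norm_def]

theorem coeFn_zakIsometry [SigmaFinite μ] (hC : IsTilingSet Γ μ C) (hJ : IsJacobian μ J)
    (ψ : Lp ℂ 2 μ) : zakIsometry hC hJ ψ =ᵐ[μ.restrict C] zak J ψ :=
  MemLp.coeFn_toLp (hC.memLp_zak hJ (Lp.memLp ψ))

/-- Quasi-periodicity of the Zak transform. -/
theorem IsTilingSet.zak_repSigma [SigmaFinite μ] (hC : IsTilingSet Γ μ C) (hJ : IsJacobian μ J)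
    (g : Γ) (ψ : Lp ℂ 2 μ) :
    ∀ᵐ x ∂μ, zak J (repSigma hJ g ψ) x = mulLeft (lamV g) (zak J ψ x) := by
  filter_upwards [hJ.zak_congr_ae (coeFn_repIsometry hJ g ψ),
    ae_all_iff.mpr fun γ => hJ.actFun_actFun γ g ψ,
    hC.ae_summable_zakTerm hJ (Lp.memLp ψ)] with x h1 h2 hs
  refine Eq.trans h1 ?_
  -- Continuity takes `λ(g)` inside the sum. After the shift `γ ↦ γg` the terms agree, since
  -- `T_σ(γ)T_σ(g) = T_σ(γg)` and `λ(g)λ(γg)* = λ(γ)*`.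
  rw [zak, zak, (mulLeft (lamV g)).map_tsum hs,
    ← (Equiv.mulRight g).tsum_eq fun γ => mulLeft (lamV g) (zakTerm J ψ x γ)]
  refine tsum_congr fun γ => ?_
  rw [Equiv.coe_mulRight, zakTerm, zakTerm, map_smul, mulLeft_lamV_toL2_star, h2 γ,
    mul_inv_cancel_right]

/-- Boundedness of the product dominates the integrand by a multiple of `‖Z[φ]‖ ‖Z[ψ]‖`, a product
of two functions in `L²(C)`. The value of the constant is immaterial. -/
theorem IsTilingSet.integrableOn_mulStar_zak [SigmaFinite μ] (hC : IsTilingSet Γ μ C)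
    (hJ : IsJacobian μ J) {φ ψ : X → ℂ} (hφ : MemLp φ 2 μ) (hψ : MemLp ψ 2 μ) :
    IntegrableOn (fun x => mulStar Γ (zak J φ x) (zak J ψ x)) C μ := by
  have h1 := hC.memLp_zak hJ hφ
  have h2 := hC.memLp_zak hJ hψ
  have hint : Integrable (fun x => ‖mulStar Γ‖ * (‖zak J φ x‖ * ‖zak J ψ x‖)) (μ.restrict C) :=
    (h1.norm.integrable_mul h2.norm).const_mul _
  refine hint.mono' (continuous_mulStar.comp_aestronglyMeasurable (h1.1.prodMk h2.1)) (.of_forall fun x => ?_)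
  rw [← mul_assoc]
  exact norm_mulStar_le _ _

theorem IsTilingSet.isBracket_zak [SigmaFinite μ] (hC : IsTilingSet Γ μ C)
    (hJ : IsJacobian μ J) :
    IsBracket (repSigma hJ) fun φ ψ => ∫ x in C, mulStar Γ (zak J φ x) (zak J ψ x) ∂μ := by
  intro φ ψ γ
  have hint := hC.integrableOn_mulStar_zak hJ (Lp.memLp φ) (Lp.memLp ψ)
  -- Multiplication by `λ(γ)*` and the trace are bounded, so they pass inside the Bochner integral.
  -- On the other side the isometry turns the inner product over `X` into an integral over `C`,
  -- which leaves a pointwise identity.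
  rw [← (mulRight (star (lamV γ))).integral_comp_comm hint,
    ← (trL1 Γ).integral_comp_comm ((mulRight (star (lamV γ))).integrable_comp hint),
    ← (zakIsometry hC hJ).inner_map_map, L2.inner_def]
  refine integral_congr_ae ?_
  filter_upwards [coeFn_zakIsometry hC hJ φ, coeFn_zakIsometry hC hJ (repSigma hJ γ ψ),
    ae_restrict_of_ae (hC.zak_repSigma hJ γ ψ)] with x h1 h2 h3
  rw [h1, h2, h3, trL1_mulRight_mulStar, star_star]

end Zak

end NCZak

theorem theoremB {Γ : Type*} [Group Γ] [Countable Γ] {X : Type*} [MeasurableSpace X]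
    [MulAction Γ X] [MeasurableConstSMul Γ X] (μ : Measure X) [SigmaFinite μ]
    (J : Γ → X → ℝ) (hJ : IsJacobian μ J) (C : Set X) (hC : IsTilingSet Γ μ C) :
    -- the series defining the Zak transform converges in `L²(vNa(Γ))` almost everywhere
    (∀ ψ : Lp ℂ 2 μ, ∀ᵐ x ∂μ, Summable (zakTerm J ψ x)) ∧
    -- the Zak transform is an isometry from `L²(X, μ)` to `L²((C, μ), L²(vNa(Γ)))`
    (∃ Z : Lp ℂ 2 μ →ₗᵢ[ℂ] Lp (L2 Γ) 2 (μ.restrict C),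
      ∀ ψ : Lp ℂ 2 μ, Z ψ =ᵐ[μ.restrict C] zak J ψ) ∧
    -- quasi-periodicity
    (∀ (γ : Γ) (ψ : Lp ℂ 2 μ), ∀ᵐ x ∂μ,
      zak J (repSigma hJ γ ψ) x = mulLeft (lamV γ) (zak J ψ x)) ∧
    -- dual integrability, with the bracket given by the Zak transform
    DualIntegrable (repSigma hJ) ∧
    (∀ φ ψ : Lp ℂ 2 μ, IntegrableOn (fun x => mulStar Γ (zak J φ x) (zak J ψ x)) C μ) ∧
    IsBracket (repSigma hJ)
      (fun φ ψ => ∫ x in C, mulStar Γ (zak J φ x) (zak J ψ x) ∂μ) := by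
  exact ⟨fun ψ => hC.ae_summable_zakTerm hJ (Lp.memLp ψ),
    ⟨zakIsometry hC hJ, coeFn_zakIsometry hC hJ⟩, hC.zak_repSigma hJ,
    ⟨_, hC.isBracket_zak hJ⟩,
    fun φ ψ => hC.integrableOn_mulStar_zak hJ (Lp.memLp φ) (Lp.memLp ψ), hC.isBracket_zak hJ⟩
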